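/- \textbf{Setting.} Let $n_d,n_c\ge 0$ be integers, $q=\max(n_d,n_c)$, and for $u\le q$ let $S_u\in\mathbb F_2^{q\times q}$ be the shift matrix whose lower-left $u\times u$ block is the identity and whose other entries are zero. In the quasi-static two-user bursty interference channel with blocklength $N$, the inputs $X_1,X_2$ and outputs $Y_1,Y_2$ are in $\mathbb F_2^{q\times N}$ and $$Y_1=S_{n_d}X_1\oplus B_1S_{n_c}X_2,\qquad Y_2=S_{n_d}X_2\oplus B_2S_{n_c}X_1,$$ where $B_1,B_2$ are independent Bernoulli variables with $\Pr\{B_i=1\}=p$, constant over the block. With global CSIRT, all encoders and decoders know $B=(B_1,B_2)$. For nonnegative rates $R_i$ and $\Delta R_i(b)$, $i=1,2$, $b\in\{00,01,10,11\}$, with $\Delta R_i(11)=0$, a code of blocklength $N$ has independent uniform messages $W_i\in\{1,\dots,\lfloor 2^{NR_i}\rfloor\}$ and $\Delta W_i(b)\in\{1,\dots,\lfloor 2^{N\Delta R_i(b)}\rfloor\}$, independent of $B$, encoders $X_i=f_i(W_i,\{\Delta W_i(b)\}_b,B)$, and decoders $(\hat W_i,\Delta\hat W_i(B))=g_i(Y_i,B)$.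 The rate tuple $(R_1,R_2,\{\Delta R_1(b)\}_b,\{\Delta R_2(b)\}_b)$ is achievable if for some sequence of codes, as $N\to\infty$, $\Pr\{\hat W_1\ne W_1\text{ or }\hat W_2\neq W_2\}\to0$ and, for $i=1,2$ and every $b$, $\Pr\{(\hat W_i,\Delta\hat W_i(b))\ne(W_i,\Delta W_i(b))\mid B=b\}\to0$. The capacity region is the closure of the set of achievable rate tuples. The opportunistic sum capacity region is the set of the tuples $(R,\Delta R(00),\Delta R(01),\Delta R(10))$ of all rate tuples in the capacity region, where $R=R_1+R_2$ and $\Delta R(b)=\Delta R_1(b)+\Delta R_2(b)$. \textbf{Theorem.} Let $0<p<1$. The opportunistic sum capacity region is the set of all nonnegative tuples $(R,\Delta R(00),\Delta R(01),\Delta R(10))$ such that $$R\le 2n_d,\qquad R\le (n_d-n_c)^++\max(n_d,n_c),\qquad R\le 2\max\{(n_d-n_c)^+,n_c\},$$ $$R+\Delta R(00)\le 2n_d,$$ $$R+\Delta R(01)\le \min\{2n_d,\ (n_d-n_c)^++\max(n_d,n_c)\},$$ $$R+\Delta R(10)\le \min\{2n_d,\ (n_d-n_c)^++\max(n_d,n_c)\}.$$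 (If $n_c\le 2n_d$, both minima equal $(n_d-n_c)^++\max(n_d,n_c)$; only for $n_c>2n_d$ is $2n_d$ the smaller term.) -/

import Mathlib

/-! # Two-user quasi-static bursty interference channel with global CSIRT

Linear deterministic model.  The two users are indexed by `Fin 2`; the other user of `i` is `i + 1`
(addition in `Fin 2`). -/

open MeasureTheory ProbabilityTheory Filter Topology
open scoped Matrix

noncomputable section

namespace BurstyIC

/-- An interference state `b = (b₁, b₂)`: `b i = true` iff receiver `i` suffers interference. -/
abbrev State : Type := Fin 2 → Bool

/-- The state `[0,0]`. -/
def s00 : State := ![false, false]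
/-- The state `[0,1]`. -/
def s01 : State := ![false, true]
/-- The state `[1,0]`. -/
def s10 : State := ![true, false]
/-- The state `[1,1]`. -/
def s11 : State := ![true, true]

/-- The `q × q` shift matrix over `𝔽₂` whose lower left `u × u` block is the identity and all of
whose other entries vanish (`u ≤ q`): it moves the `u` top entries of a vector to the bottom. -/
def shiftMatrix (q u : ℕ) : Matrix (Fin q) (Fin q) (ZMod 2) :=
  Matrix.of fun r c => if (r : ℕ) = (c : ℕ) + (q - u) then 1 else 0

/-- A block of `N` channel symbols, each of them a vector in `𝔽₂^q`, `q = max n_d n_c`. -/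
abbrev Block (nd nc N : ℕ) : Type := Matrix (Fin (max nd nc)) (Fin N) (ZMod 2)

/-- The channel in state `b`: `Y i = S_{n_d} X i ⊕ b i • S_{n_c} X j`, with `j ≠ i`. -/
def channelOutput (nd nc : ℕ) {N : ℕ} (b : State) (X : Fin 2 → Block nd nc N) (i : Fin 2) :
    Block nd nc N :=
  shiftMatrix (max nd nc) nd * X i +
    if b i then shiftMatrix (max nd nc) nc * X (i + 1) else 0

/-- Rate tuples: the worst-case rates `R i`, and the opportunistic rates `ΔR i b`
for every user `i` and every interference state `b`. -/
abbrev RateTuple : Type := (Fin 2 → ℝ) × (Fin 2 → State → ℝ)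

/-- Number of messages at rate `r` and blocklength `N`: `2 ^ (N r)`, rounded down. -/
def msgCount (N : ℕ) (r : ℝ) : ℕ := ⌊(2 : ℝ) ^ ((N : ℝ) * r)⌋₊

/-- The messages of user `i`: a worst-case message and one opportunistic message per state. -/
abbrev UserMessages (N : ℕ) (ρ : RateTuple) (i : Fin 2) : Type :=
  Fin (msgCount N (ρ.1 i)) × ((b : State) → Fin (msgCount N (ρ.2 i b)))

/-- The messages of both users. -/
abbrev Messages (N : ℕ) (ρ : RateTuple) : Type := (i : Fin 2) → UserMessages N ρ i

/-- An opportunistic code of blocklength `N` with rates `ρ` for global CSIRT: the encoders and the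
decoders all know the state `b = (b₁, b₂)`.  In state `b`, decoder `i` outputs estimates of the
worst-case message and of the opportunistic message that belongs to `b`. -/
structure OpportunisticCode (nd nc N : ℕ) (ρ : RateTuple) where
  /-- the encoders -/
  enc : (i : Fin 2) → UserMessages N ρ i → State → Block nd nc N
  /-- the decoders -/
  dec : (i : Fin 2) → Block nd nc N → (b : State) →
    Fin (msgCount N (ρ.1 i)) × Fin (msgCount N (ρ.2 i b))

/-- Decoder `i`'s estimates when the messages are `m` and the state is `b`. -/
def OpportunisticCode.decoded {nd nc N : ℕ} {ρ : RateTuple} (c : OpportunisticCode nd nc N ρ)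
    (m : Messages N ρ) (b : State) (i : Fin 2) :
    Fin (msgCount N (ρ.1 i)) × Fin (msgCount N (ρ.2 i b)) :=
  c.dec i (channelOutput nd nc b (fun j => c.enc j (m j) b) i) b

/-- The law of the interference state: `B₁`, `B₂` are independent Bernoulli variables with
activation probability `p`. -/
def stateLaw (p : unitInterval) : Measure State :=
  Measure.pi fun _ : Fin 2 => bernoulliMeasure true false p

/-- The joint law of messages and state: all messages are uniform and independent, and they are
independent of the state. -/
def jointLaw (N : ℕ) (ρ : RateTuple) (p : unitInterval) : Measure (Messages N ρ × State) :=
  (uniformOn (Set.univ : Set (Messages N ρ))).prod (stateLaw p)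

/-- The event that some decoder gets its worst-case message wrong. -/
def worstCaseError {nd nc N : ℕ} {ρ : RateTuple} (c : OpportunisticCode nd nc N ρ) :
    Set (Messages N ρ × State) :=
  {ω | ∃ i, (c.decoded ω.1 ω.2 i).1 ≠ (ω.1 i).1}

/-- The event that decoder `i` gets its worst-case message or the opportunistic message of the
actual state wrong. -/
def opportunisticError {nd nc N : ℕ} {ρ : RateTuple} (c : OpportunisticCode nd nc N ρ)
    (i : Fin 2) : Set (Messages N ρ × State) :=
  {ω | c.decoded ω.1 ω.2 i ≠ ((ω.1 i).1, (ω.1 i).2 ω.2)}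

/-- The event that the interference state is `b`. -/
def stateEvent (N : ℕ) (ρ : RateTuple) (b : State) : Set (Messages N ρ × State) :=
  {ω | ω.2 = b}

/-- Achievable rate tuples for global CSIRT and independent interference states.  Rates are
nonnegative, and the opportunistic rates of the state `[1,1]` are zero. -/
def IsAchievable (nd nc : ℕ) (p : unitInterval) (ρ : RateTuple) : Prop :=
  (∀ i, 0 ≤ ρ.1 i) ∧ (∀ i b, 0 ≤ ρ.2 i b) ∧ (∀ i, ρ.2 i s11 = 0) ∧
  ∃ c : (N : ℕ) → OpportunisticCode nd nc N ρ,
    Tendsto (fun N => (jointLaw N ρ p).real (worstCaseError (c N))) atTop (𝓝 0) ∧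
    ∀ i b, Tendsto (fun N =>
      ((jointLaw N ρ p)[|stateEvent N ρ b]).real (opportunisticError (c N) i)) atTop (𝓝 0)

/-- The capacity region: the closure of the set of achievable rate tuples. -/
def capacityRegion (nd nc : ℕ) (p : unitInterval) : Set RateTuple :=
  closure {ρ | IsAchievable nd nc p ρ}

/-- The sum rates `(R, ΔR(00), ΔR(01), ΔR(10))` of a rate tuple, where `R = R₁ + R₂` and
`ΔR(b) = ΔR₁(b) + ΔR₂(b)`. -/
def sumRates (ρ : RateTuple) : ℝ × ℝ × ℝ × ℝ :=
  (∑ i, ρ.1 i, ∑ i, ρ.2 i s00, ∑ i, ρ.2 i s01, ∑ i, ρ.2 i s10)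

/-- The opportunistic sum capacity region: the set of the sum rates
`(R, ΔR(00), ΔR(01), ΔR(10))` of all rate tuples in the capacity region. -/
def opportunisticSumCapacityRegion (nd nc : ℕ) (p : unitInterval) : Set (ℝ × ℝ × ℝ × ℝ) :=
  sumRates '' capacityRegion nd nc p

end BurstyIC

end

noncomputable section

namespace BurstyIC

/-! Since all terminals know the state, the states decouple: in state `b` the pair of messages (W_i,
ΔW_i(b)) acts as a single message of rate R_i + ΔR_i(b) on the deterministic interference channel
frozen in `b`. The region thus reflects the sum capacity of each frozen channel (`sumCapacity`);
state 11 has no opportunistic message and constrains R alone.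

Converse: as 0 < p < 1, every state has positive probability, so conditioned on `b` at least half of
the message tuples are eventually decoded by both receivers. Fixing the messages meant for other
states leaves a set `G` of good tuples, and entropy arguments become cardinality bounds on `G`:
`card_le_direct` (single-user bound), `card_le_interference` (an interfered receiver decodes its own
message, then resolves the interferer with the help of nd - nc further levels) and
`card_sq_le_interference` (each receiver is given the interference its own transmitter causes).
Constant factors vanish at exponential scale.

Achievability: in each state an explicit scheme for one channel use reaches the sum capacity without
error (`exists_oneShot`). Alternating it with a complementary scheme gives each user half of that
sum. Only sum rates matter, so a symmetric rate tuple suffices; taking the closure removes the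
rounding loss. -/

/-- The entry at time `t` of row `j` of a block, `0` if there is no row `j`. -/
def rowEntry {nd nc N : ℕ} (X : Block nd nc N) (t : Fin N) (j : ℕ) : ZMod 2 :=
  if h : j < max nd nc then X ⟨j, h⟩ t else 0

/-- Row `r` of the output of receiver `i` in one channel use, as a function of the level sequences
`x 0`, `x 1` that the transmitters send. -/
def levelOutput (nd nc : ℕ) (b : State) (x : Fin 2 → ℕ → ZMod 2) (i : Fin 2) (r : ℕ) : ZMod 2 :=
  (if max nd nc - nd ≤ r then x i (r - (max nd nc - nd)) else 0) +
    if b i then (if max nd nc - nc ≤ r then x (i + 1) (r - (max nd nc - nc)) else 0) else 0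

lemma shiftMatrix_mul_apply {nd nc N u : ℕ} (X : Block nd nc N)
    (r : Fin (max nd nc)) (t : Fin N) :
    (shiftMatrix (max nd nc) u * X) r t =
      if max nd nc - u ≤ r then rowEntry X t (r - (max nd nc - u)) else 0 := by
  have hr := r.2
  rw [Matrix.mul_apply]
  split_ifs with h
  · have hlt : (r : ℕ) - (max nd nc - u) < max nd nc := by omega
    rw [Finset.sum_eq_single ⟨(r : ℕ) - (max nd nc - u), hlt⟩]
    · rw [rowEntry, dif_pos hlt]
      simp only [shiftMatrix, Matrix.of_apply]
      rw [if_pos (by omega), one_mul]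
    · intro c _ hc
      simp only [shiftMatrix, Matrix.of_apply]
      rw [if_neg, zero_mul]
      intro h'
      apply hc
      ext
      simp only
      omega
    · simp
  · apply Finset.sum_eq_zero
    intro c _
    simp only [shiftMatrix, Matrix.of_apply]
    rw [if_neg (by omega), zero_mul]

lemma channelOutput_apply {nd nc N : ℕ} (b : State) (X : Fin 2 → Block nd nc N) (i : Fin 2)
    (r : Fin (max nd nc)) (t : Fin N) :
    channelOutput nd nc b X i r t = levelOutput nd nc b (fun j => rowEntry (X j) t) i r := by
  rw [channelOutput, levelOutput, Matrix.add_apply, shiftMatrix_mul_apply]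
  cases b i
  · simp
  · simp [shiftMatrix_mul_apply]

lemma rowEntry_of_lt {nd nc N : ℕ} (X : Block nd nc N) (t : Fin N) {j : ℕ} (h : j < max nd nc) :
    rowEntry X t j = X ⟨j, h⟩ t := dif_pos h

lemma block_ext {nd nc N : ℕ} {X X' : Block nd nc N}
    (h : ∀ t, ∀ j < max nd nc, rowEntry X t j = rowEntry X' t j) : X = X' := by
  ext r t
  simpa [rowEntry_of_lt _ t r.2] using h t r r.2

lemma fin_two_eq_or (i j : Fin 2) : j = i ∨ j = i + 1 := by
  revert i j; decide

lemma fin_two_add_add (i : Fin 2) : i + 1 + 1 = i := by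
  revert i; decide

/-- Subtracting the known own signal from an interfered output exposes the top nc levels of the
other transmitter. -/
lemma rowEntry_eq_of_output_eq {nd nc N : ℕ} (b : State) {X X' : Fin 2 → Block nd nc N}
    (i : Fin 2) (hb : b i = true) (hi : X i = X' i)
    (hY : channelOutput nd nc b X i = channelOutput nd nc b X' i) (t : Fin N) (j : ℕ)
    (hj : j < nc) :
    rowEntry (X (i + 1)) t j = rowEntry (X' (i + 1)) t j := by
  have hr : j + (max nd nc - nc) < max nd nc := by omega
  have h := congrFun (congrFun hY ⟨_, hr⟩) t
  rw [channelOutput_apply, channelOutput_apply] at h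
  simpa [levelOutput, hb, hi] using h

/-! ### Cardinality bounds from one receiver -/

section Counting

variable {nd nc N : ℕ} {A : Fin 2 → Type}
  (b : State) (e : (i : Fin 2) → A i → Block nd nc N) (d : (i : Fin 2) → Block nd nc N → A i)
  (G : Finset ((i : Fin 2) → A i))
  (hG : ∀ a ∈ G, ∀ i, d i (channelOutput nd nc b (fun j => e j (a j)) i) = a i)

include hG

/-- Once the other user's message is known, the output, and hence the decoded message, depends only
on the top nd levels of the own input. -/
lemma card_le_direct [∀ i, Fintype (A i)] (i : Fin 2) :
    G.card ≤ 2 ^ (N * nd) * Fintype.card (A (i + 1)) := by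
  classical
  have hcard : Fintype.card ((Fin nd → Fin N → ZMod 2) × A (i + 1)) =
      2 ^ (N * nd) * Fintype.card (A (i + 1)) := by
    simp [pow_mul]
  rw [← hcard, ← Finset.card_univ]
  refine Finset.card_le_card_of_injOn
    (fun a => ((fun r t => rowEntry (e i (a i)) t r : Fin nd → Fin N → ZMod 2), a (i + 1)))
    (fun _ _ => Finset.mem_univ _) ?_
  intro a ha a' ha' h
  simp only [Prod.mk.injEq] at h
  obtain ⟨h1, h2⟩ := h
  have hi : a i = a' i := by
    rw [← hG a ha i, ← hG a' ha' i]
    congr 1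
    ext r t
    rw [channelOutput_apply, channelOutput_apply]
    simp only [levelOutput, h2]
    congr 1
    split_ifs with hr
    · have hr2 := r.2
      have : (r : ℕ) - (max nd nc - nd) < nd := by omega
      exact congrFun (congrFun h1 ⟨_, this⟩) t
    · rfl
  funext j
  rcases fin_two_eq_or i j with rfl | rfl
  · exact hi
  · exact h2

/-- The output of an interfered receiver yields its message and then the top nc levels of the
interferer. The remaining nd - nc levels complete the interferer's block, so both inputs, and hence
both decoded messages, are determined. -/
lemma card_le_interference (i : Fin 2) (hb : b i = true) :
    G.card ≤ 2 ^ (N * (max nd nc + (nd - nc))) := by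
  classical
  have hcard : Fintype.card (Block nd nc N × (Fin (nd - nc) → Fin N → ZMod 2)) =
      2 ^ (N * (max nd nc + (nd - nc))) := by
    simp [Matrix, pow_mul, pow_add, mul_add]
  rw [← hcard, ← Finset.card_univ]
  refine Finset.card_le_card_of_injOn
    (fun a => (channelOutput nd nc b (fun j => e j (a j)) i,
      (fun r t => rowEntry (e (i + 1) (a (i + 1))) t (nc + r) : Fin (nd - nc) → Fin N → ZMod 2)))
    (fun _ _ => Finset.mem_univ _) ?_
  intro a ha a' ha' h
  simp only [Prod.mk.injEq] at h
  obtain ⟨h1, h2⟩ := h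
  have hi : a i = a' i := by rw [← hG a ha i, ← hG a' ha' i, h1]
  have he : e (i + 1) (a (i + 1)) = e (i + 1) (a' (i + 1)) := by
    refine block_ext fun t j hj => ?_
    by_cases hjc : j < nc
    · exact rowEntry_eq_of_output_eq b i hb (congrArg (e i) hi) h1 t j hjc
    · have := congrFun (congrFun h2 ⟨j - nc, by omega⟩) t
      simpa [Nat.add_sub_cancel' (not_lt.1 hjc)] using this
  have hX : (fun j => e j (a j)) = fun j => e j (a' j) := by
    funext j
    rcases fin_two_eq_or i j with rfl | rfl
    · rw [hi]
    · exact he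
  funext j
  rw [← hG a ha j, ← hG a' ha' j, hX]

end Counting

lemma card_image_le_of_factors {ι κ θ : Type*} [DecidableEq κ] [Fintype θ]
    (S : Finset ι) (φ : ι → κ) (ψ : ι → θ)
    (h : ∀ a ∈ S, ∀ a' ∈ S, ψ a = ψ a' → φ a = φ a') :
    (S.image φ).card ≤ Fintype.card θ := by
  classical
  have hs : ∀ k ∈ S.image φ, ∃ a ∈ S, φ a = k := fun k hk => by simpa using hk
  choose s hs1 hs2 using hs
  rw [← Fintype.card_coe]
  refine Fintype.card_le_of_injective (fun k : S.image φ => ψ (s k.1 k.2)) fun k k' hkk => ?_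
  ext
  rw [← hs2 k.1 k.2, ← hs2 k'.1 k'.2]
  exact h _ (hs1 _ _) _ (hs1 _ _) hkk

/-! ### Genie-aided bound, with Cauchy–Schwarz in place of entropies -/

section Genie

variable {ι α β V : Type*} [Fintype α] [Fintype β] [Fintype V] [DecidableEq V] [DecidableEq α]
  [DecidableEq β]

/-- For fixed `v`, summing the second factor over `w` counts pairs `(a x, g x)`, at most `T` of
them; the fibres of `f` then sum to the whole of `α`. -/
lemma sum_card_mul_card_image_le (G : Finset ι) (a : ι → α) (f : α → V) (g : ι → V) (T : ℕ)
    (h : ∀ v, ((G.filter fun x => f (a x) = v).image fun x => (a x, g x)).card ≤ T) :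
    ∑ p : V × V, (Finset.univ.filter fun y => f y = p.1).card *
        ((G.filter fun x => f (a x) = p.1 ∧ g x = p.2).image a).card ≤ Fintype.card α * T := by
  rw [Fintype.sum_prod_type]
  have hα : Fintype.card α = ∑ v, (Finset.univ.filter fun y => f y = v).card := by
    rw [← Finset.card_univ]
    exact Finset.card_eq_sum_card_fiberwise fun _ _ => Finset.mem_univ _
  rw [hα, Finset.sum_mul]
  refine Finset.sum_le_sum fun v _ => ?_
  simp only
  rw [← Finset.mul_sum]
  refine Nat.mul_le_mul_left _ (le_trans ?_ (h v))
  rw [Finset.card_eq_sum_card_fiberwise (f := Prod.snd) (t := Finset.univ)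
    fun _ _ => Finset.mem_univ _]
  refine Finset.sum_le_sum fun w _ => ?_
  refine Finset.card_le_card_of_injOn (fun y => (y, w)) ?_ ?_
  · intro y hy
    simp only [Finset.coe_image, Set.mem_image, Finset.mem_coe, Finset.mem_filter] at hy
    obtain ⟨x, ⟨hx, hx1, hx2⟩, rfl⟩ := hy
    simp only [Finset.mem_coe, Finset.mem_filter, Finset.mem_image, and_true]
    exact ⟨x, ⟨hx, hx1⟩, by rw [hx2]⟩
  · intro y _ y' _ h
    exact (Prod.mk.inj h).1

lemma card_sq_le_genie (G : Finset ι) (a : ι → α) (b : ι → β) (f : α → V) (g : β → V) (T : ℕ)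
    (hinj : ∀ x ∈ G, ∀ x' ∈ G, a x = a x' → b x = b x' → x = x')
    (hf : ∀ v, ((G.filter fun x => f (a x) = v).image fun x => (a x, g (b x))).card ≤ T)
    (hg : ∀ v, ((G.filter fun x => g (b x) = v).image fun x => (b x, f (a x))).card ≤ T) :
    G.card ^ 2 ≤ (Fintype.card α * T) * (Fintype.card β * T) := by
  classical
  set S : V × V → Finset ι := fun p => G.filter fun x => f (a x) = p.1 ∧ g (b x) = p.2 with hS
  have h1 := sum_card_mul_card_image_le G a f (fun x => g (b x)) T hf
  have h2 := sum_card_mul_card_image_le G b g (fun x => f (a x)) T hg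
  have h2' : ∑ p : V × V, (Finset.univ.filter fun y => g y = p.2).card * ((S p).image b).card ≤
      Fintype.card β * T := by
    refine le_trans (le_of_eq ?_) h2
    exact Fintype.sum_equiv (Equiv.prodComm V V) _ _ fun p => by
      simp [hS, and_comm]
      exact Or.inl rfl
  have hcard : G.card = ∑ p : V × V, (S p).card := by
    rw [Finset.card_eq_sum_card_fiberwise (f := fun x => (f (a x), g (b x))) (t := Finset.univ)
      fun _ _ => Finset.mem_univ _]
    refine Finset.sum_congr rfl fun p _ => ?_
    simp [hS, Prod.ext_iff]
  rw [hcard]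
  refine le_trans ?_ (Nat.mul_le_mul h1 h2')
  -- Cauchy–Schwarz over the pairs of side informations. A cell has at most as many elements as the
  -- product of its two projections, and each projection lies in a fibre of `f` or `g`; using each
  -- projection once as itself and once through its fibre gives the termwise bound.
  refine Finset.sum_sq_le_sum_mul_sum_of_sq_le_mul _ (fun _ _ => Nat.zero_le _)
    (fun _ _ => Nat.zero_le _) fun p _ => ?_
  have hprod : (S p).card ≤ ((S p).image a).card * ((S p).image b).card := by
    rw [← Finset.card_product]
    refine Finset.card_le_card_of_injOn (fun x => (a x, b x)) ?_ ?_
    · intro x hx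
      exact Finset.mem_coe.2 (Finset.mem_product.2
        ⟨Finset.mem_image_of_mem a hx, Finset.mem_image_of_mem b hx⟩)
    · intro x hx x' hx' h
      exact hinj x (Finset.mem_filter.1 hx).1 x' (Finset.mem_filter.1 hx').1
        (Prod.mk.inj h).1 (Prod.mk.inj h).2
  have ha : ((S p).image a).card ≤ (Finset.univ.filter fun y => f y = p.1).card := by
    refine Finset.card_le_card fun y hy => ?_
    obtain ⟨x, hx, rfl⟩ := Finset.mem_image.1 hy
    simpa using (Finset.mem_filter.1 hx).2.1
  have hb : ((S p).image b).card ≤ (Finset.univ.filter fun y => g y = p.2).card := by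
    refine Finset.card_le_card fun y hy => ?_
    obtain ⟨x, hx, rfl⟩ := Finset.mem_image.1 hy
    simpa using (Finset.mem_filter.1 hx).2.2
  calc (S p).card ^ 2 ≤ (((S p).image a).card * ((S p).image b).card) ^ 2 :=
        Nat.pow_le_pow_left hprod 2
    _ = (((S p).image a).card * ((S p).image a).card) *
        (((S p).image b).card * ((S p).image b).card) := by ring
    _ ≤ _ := Nat.mul_le_mul (Nat.mul_le_mul_right _ ha) (Nat.mul_le_mul_right _ hb)

end Genie

section GenieChannel

variable {nd nc N : ℕ} {A : Fin 2 → Type}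
  (b : State) (e : (i : Fin 2) → A i → Block nd nc N) (d : (i : Fin 2) → Block nd nc N → A i)
  (G : Finset ((i : Fin 2) → A i))
  (hG : ∀ a ∈ G, ∀ i, d i (channelOutput nd nc b (fun j => e j (a j)) i) = a i)

include hG

/-- Given the top nc levels of the own input, the upper output rows are free of interference and
already known. The lowest max(nd - nc, nc) rows thus fix the output, the decoded message and the
interference. -/
lemma card_image_le_genie [∀ i, DecidableEq (A i)] (i : Fin 2) (hb : b i = true)
    (v : Fin nc → Fin N → ZMod 2) :
    ((G.filter fun a => (fun (r : Fin nc) t => rowEntry (e i (a i)) t r) = v).image fun a =>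
      (a i, fun (r : Fin nc) t => rowEntry (e (i + 1) (a (i + 1))) t r)).card ≤
      2 ^ (N * max (nd - nc) nc) := by
  set τ := max (nd - nc) nc with hτ
  have hτq : τ ≤ max nd nc := by omega
  have hcard : Fintype.card (Fin τ → Fin N → ZMod 2) = 2 ^ (N * τ) := by
    simp [pow_mul]
  rw [← hcard]
  refine card_image_le_of_factors _ _ (fun a (r : Fin τ) t =>
    rowEntry (channelOutput nd nc b (fun j => e j (a j)) i) t (max nd nc - τ + r)) ?_
  intro a ha a' ha' h
  obtain ⟨haG, hav⟩ := Finset.mem_filter.1 ha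
  obtain ⟨haG', hav'⟩ := Finset.mem_filter.1 ha'
  have hv := hav.trans hav'.symm
  have hY : channelOutput nd nc b (fun j => e j (a j)) i =
      channelOutput nd nc b (fun j => e j (a' j)) i := by
    refine block_ext fun t j hj => ?_
    by_cases hjt : j < max nd nc - τ
    · rw [rowEntry_of_lt _ _ hj, rowEntry_of_lt _ _ hj, channelOutput_apply, channelOutput_apply]
      simp only [levelOutput]
      rw [if_neg (show ¬ max nd nc - nc ≤ j by omega), if_neg (show ¬ max nd nc - nc ≤ j by omega),
        if_pos (show max nd nc - nd ≤ j by omega), if_pos (show max nd nc - nd ≤ j by omega)]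
      congr 1
      exact congrFun (congrFun hv ⟨j - (max nd nc - nd), by omega⟩) t
    · have := congrFun (congrFun h ⟨j - (max nd nc - τ), by omega⟩) t
      simpa [Nat.add_sub_cancel' (not_lt.1 hjt)] using this
  have hi : a i = a' i := by rw [← hG a haG i, ← hG a' haG' i, hY]
  refine Prod.ext hi ?_
  funext r t
  exact rowEntry_eq_of_output_eq b i hb (congrArg (e i) hi) hY t r r.2

lemma card_sq_le_interference [∀ i, Fintype (A i)] (hb0 : b 0 = true) (hb1 : b 1 = true) :
    G.card ^ 2 ≤ (Fintype.card (A 0) * 2 ^ (N * max (nd - nc) nc)) *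
      (Fintype.card (A 1) * 2 ^ (N * max (nd - nc) nc)) := by
  classical
  refine card_sq_le_genie G (fun a => a 0) (fun a => a 1)
    (fun y (r : Fin nc) t => rowEntry (e 0 y) t r) (fun y (r : Fin nc) t => rowEntry (e 1 y) t r)
    _ ?_ (card_image_le_genie b e d G hG 0 hb0) (card_image_le_genie b e d G hG 1 hb1)
  intro x _ x' _ h0 h1
  funext j
  fin_cases j
  · exact h0
  · exact h1

end GenieChannel

/-! ### From error probabilities to counting -/

lemma stateLaw_singleton_ne_zero {p : unitInterval} (hp0 : 0 < p) (hp1 : p < 1) (b : State) :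
    (stateLaw p).real {b} ≠ 0 := by
  have h0 : (p : ℝ) ≠ 0 := ne_of_gt (by exact_mod_cast hp0)
  have h1 : (1 - p : ℝ) ≠ 0 := sub_ne_zero.2 (ne_of_gt (by exact_mod_cast hp1))
  rw [stateLaw, measureReal_def, Measure.pi_singleton, ENNReal.toReal_prod,
    Finset.prod_ne_zero_iff]
  intro i _
  rw [← measureReal_def]
  cases b i
  · rw [bernoulliMeasure_real_apply_of_notMem_of_mem] <;> simp [h1]
  · rw [bernoulliMeasure_real_apply_of_mem_of_notMem] <;> simp [h0]

lemma cond_jointLaw_real {N : ℕ} {ρ : RateTuple} {p : unitInterval} (hp0 : 0 < p) (hp1 : p < 1)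
    [Nonempty (Messages N ρ)]
    (b : State) (S : Set (Messages N ρ × State)) :
    ((jointLaw N ρ p)[|stateEvent N ρ b]).real S =
      (Nat.card {m // (m, b) ∈ S} : ℝ) / Fintype.card (Messages N ρ) := by
  have hs : MeasurableSet (stateEvent N ρ b) := Set.toFinite _ |>.measurableSet
  have hprod : stateEvent N ρ b ∩ S = {m : Messages N ρ | (m, b) ∈ S} ×ˢ {b} := by
    ext ⟨m, b'⟩
    simp only [stateEvent, Set.mem_inter_iff, Set.mem_ofPred_eq, Set.mem_prod,
      Set.mem_singleton_iff]
    constructor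
    · rintro ⟨rfl, h⟩
      exact ⟨h, rfl⟩
    · rintro ⟨h, rfl⟩
      exact ⟨rfl, h⟩
  have huniv : stateEvent N ρ b = Set.univ ×ˢ {b} := by
    ext ⟨m, b'⟩
    simp [stateEvent]
  have hunif (T : Set (Messages N ρ)) : (uniformOn (Set.univ : Set (Messages N ρ))).real T =
      Nat.card T / Fintype.card (Messages N ρ) := by
    rw [measureReal_def, uniformOn_univ, Measure.count_apply_finite _ (Set.toFinite _),
      ENNReal.toReal_div, ENNReal.toReal_natCast, ENNReal.toReal_natCast,
      Nat.card_coe_set_eq, Set.ncard_eq_toFinset_card _ (Set.toFinite _)]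
  rw [measureReal_def, cond_apply hs, ENNReal.toReal_mul, ENNReal.toReal_inv, ← measureReal_def,
    ← measureReal_def, hprod, huniv, jointLaw, measureReal_prod_prod, measureReal_prod_prod,
    hunif, hunif]
  have hb := stateLaw_singleton_ne_zero hp0 hp1 b
  have hM : (Fintype.card (Messages N ρ) : ℝ) ≠ 0 := by
    exact_mod_cast Fintype.card_ne_zero
  rw [Nat.card_univ, Nat.card_eq_fintype_card, div_self hM]
  field_simp
  rfl

lemma msgCount_pos {N : ℕ} {r : ℝ} (hr : 0 ≤ r) : 0 < msgCount N r :=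
  Nat.floor_pos.2 (Real.one_le_rpow (by norm_num) (by positivity))

lemma msgCount_le (N : ℕ) (r : ℝ) : (msgCount N r : ℝ) ≤ 2 ^ ((N : ℝ) * r) :=
  Nat.floor_le (by positivity)

lemma rpow_le_two_mul_msgCount {N : ℕ} {r : ℝ} (hr : 0 ≤ r) :
    (2 : ℝ) ^ ((N : ℝ) * r) ≤ 2 * msgCount N r := by
  have h1 : (1 : ℝ) ≤ msgCount N r := by exact_mod_cast msgCount_pos hr
  have h2 : (2 : ℝ) ^ ((N : ℝ) * r) < msgCount N r + 1 := Nat.lt_floor_add_one _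
  linarith

/-- A relation that holds for at least half of all families of pairs holds, for a suitable choice
of the second components, for at least half of all families of first components. -/
lemma exists_slice {A C : Fin 2 → Type} [∀ i, Fintype (A i)] [∀ i, Fintype (C i)]
    [∀ i, DecidableEq (A i)] [∀ i, DecidableEq (C i)]
    (P : ((i : Fin 2) → A i × C i) → Prop) [DecidablePred P] [Nonempty ((i : Fin 2) → C i)]
    (h : Fintype.card ((i : Fin 2) → A i × C i) ≤ 2 * (Finset.univ.filter P).card) :
    ∃ c : (i : Fin 2) → C i, Fintype.card ((i : Fin 2) → A i) ≤
      2 * (Finset.univ.filter fun a : (i : Fin 2) → A i => P fun i => (a i, c i)).card := by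
  by_contra! hc
  have hsum := Finset.sum_lt_sum_of_nonempty (Finset.univ_nonempty (α := (i : Fin 2) → C i))
    fun c _ => hc c
  have h1 : (Finset.univ.filter P).card = ∑ c : (i : Fin 2) → C i,
      (Finset.univ.filter fun a : (i : Fin 2) → A i => P fun i => (a i, c i)).card := by
    rw [Finset.card_eq_sum_card_fiberwise (f := fun m i => (m i).2) (t := Finset.univ)
      fun _ _ => Finset.mem_univ _]
    refine Finset.sum_congr rfl fun c _ => ?_
    refine Finset.card_bij' (fun m _ i => (m i).1) (fun a _ i => (a i, c i)) ?_ ?_ ?_ ?_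
    · intro m hm
      simp only [Finset.mem_filter, Finset.mem_univ, true_and] at hm ⊢
      obtain ⟨hm, rfl⟩ := hm
      exact hm
    · intro a ha
      simpa using ha
    · intro m hm
      simp only [Finset.mem_filter, Finset.mem_univ, true_and] at hm
      obtain ⟨hm, rfl⟩ := hm
      rfl
    · intro a ha
      rfl
  have h2 : Fintype.card ((i : Fin 2) → A i × C i) =
      Fintype.card ((i : Fin 2) → C i) * Fintype.card ((i : Fin 2) → A i) := by
    simp [Fintype.card_pi, Fin.prod_univ_two]
    ring
  rw [← Finset.mul_sum, ← h1, Finset.sum_const, Finset.card_univ, smul_eq_mul, ← h2] at hsum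
  omega

/-- The messages of user `i` split into those that decoder `i` wants in state `b` and the others. -/
def splitMessages (N : ℕ) (ρ : RateTuple) (b : State) (i : Fin 2) : UserMessages N ρ i ≃
    (Fin (msgCount N (ρ.1 i)) × Fin (msgCount N (ρ.2 i b))) ×
      ((b' : {b' // b' ≠ b}) → Fin (msgCount N (ρ.2 i b'))) :=
  ((Equiv.refl _).prodCongr (Equiv.piSplitAt b fun b' => Fin (msgCount N (ρ.2 i b')))).trans
    (Equiv.prodAssoc _ _ _).symm

/-- By pigeonhole, some choice of the messages not wanted in state `b` keeps at least half of the
wanted ones decodable; it reduces the opportunistic code to an ordinary code for the frozen channel.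
-/
lemma exists_fixed_code {nd nc N : ℕ} {ρ : RateTuple} (hρ : ∀ i b, 0 ≤ ρ.2 i b)
    (c : OpportunisticCode nd nc N ρ) (b : State)
    (h : Fintype.card (Messages N ρ) ≤
      2 * Nat.card {m : Messages N ρ // ∀ i, c.decoded m b i = ((m i).1, (m i).2 b)}) :
    ∃ (e : (i : Fin 2) → Fin (msgCount N (ρ.1 i)) × Fin (msgCount N (ρ.2 i b)) → Block nd nc N)
      (G : Finset ((i : Fin 2) → Fin (msgCount N (ρ.1 i)) × Fin (msgCount N (ρ.2 i b)))),
      (∀ a ∈ G, ∀ i, c.dec i (channelOutput nd nc b (fun j => e j (a j)) i) b = a i) ∧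
      Fintype.card ((i : Fin 2) → Fin (msgCount N (ρ.1 i)) × Fin (msgCount N (ρ.2 i b))) ≤
        2 * G.card := by
  classical
  set E := Equiv.piCongrRight (splitMessages N ρ b) with hE
  have : Nonempty ((i : Fin 2) → (b' : {b' // b' ≠ b}) → Fin (msgCount N (ρ.2 i b'))) :=
    ⟨fun i b' => ⟨0, msgCount_pos (hρ i b')⟩⟩
  obtain ⟨r, hr⟩ := exists_slice
    (fun m => ∀ i, c.decoded (E.symm m) b i = (m i).1) (by
      rw [← Fintype.card_congr E]
      refine h.trans (le_of_eq ?_)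
      congr 1
      rw [← Fintype.card_subtype, ← Nat.card_eq_fintype_card]
      refine Nat.card_congr (E.subtypeEquiv fun m => ?_)
      rw [E.symm_apply_apply]
      rfl)
  refine ⟨fun i a => c.enc i ((splitMessages N ρ b i).symm (a, r i)) b, _, ?_, hr⟩
  intro a ha i
  exact (Finset.mem_filter.1 ha).2 i

lemma le_of_eventually_rpow_le {s t K : ℝ}
    (h : ∀ᶠ N : ℕ in atTop, (2 : ℝ) ^ ((N : ℝ) * s) ≤ K * 2 ^ ((N : ℝ) * t)) : s ≤ t := by
  by_contra! hst
  have h1 : Tendsto (fun N : ℕ => ((2 : ℝ) ^ (s - t)) ^ N) atTop atTop :=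
    tendsto_pow_atTop_atTop_of_one_lt (Real.one_lt_rpow (by norm_num) (by linarith))
  obtain ⟨N, hN1, hN2⟩ := (h.and (h1.eventually_gt_atTop K)).exists
  rw [← Real.rpow_natCast, ← Real.rpow_mul (by norm_num)] at hN2
  have h3 : (2 : ℝ) ^ ((N : ℝ) * s) = 2 ^ ((s - t) * N) * 2 ^ ((N : ℝ) * t) := by
    rw [← Real.rpow_add (by norm_num)]
    congr 1
    ring
  rw [h3] at hN1
  exact absurd (le_of_mul_le_mul_right hN1 (by positivity)) (not_le.2 hN2)

/-! ### Rate bounds for achievable tuples -/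

section Converse

variable {nd nc : ℕ} {p : unitInterval} {ρ : RateTuple}

lemma eventually_half_decoded (hp0 : 0 < p) (hp1 : p < 1) (b : State)
    (c : (N : ℕ) → OpportunisticCode nd nc N ρ)
    (hc : ∀ i, Tendsto (fun N =>
      ((jointLaw N ρ p)[|stateEvent N ρ b]).real (opportunisticError (c N) i)) atTop (𝓝 0))
    (h0 : ∀ i, 0 ≤ ρ.1 i) (h1 : ∀ i b, 0 ≤ ρ.2 i b) :
    ∀ᶠ N in atTop, Fintype.card (Messages N ρ) ≤
      2 * Nat.card {m : Messages N ρ // ∀ i, (c N).decoded m b i = ((m i).1, (m i).2 b)} := by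
  classical
  -- Error below 1/4 at each receiver leaves at least half of the tuples correct by the union bound.
  filter_upwards [(hc 0).eventually_lt_const (show (0 : ℝ) < 1 / 4 by norm_num),
    (hc 1).eventually_lt_const (show (0 : ℝ) < 1 / 4 by norm_num)] with N e0 e1
  have : Nonempty (Messages N ρ) :=
    ⟨fun i => (⟨0, msgCount_pos (h0 i)⟩, fun b' => ⟨0, msgCount_pos (h1 i b')⟩)⟩
  have hpos : (0 : ℝ) < Fintype.card (Messages N ρ) := by
    exact_mod_cast Fintype.card_pos
  rw [cond_jointLaw_real hp0 hp1, div_lt_iff₀ hpos, Nat.card_eq_fintype_card,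
    Fintype.card_subtype] at e0 e1
  rw [Nat.card_eq_fintype_card, Fintype.card_subtype]
  set S := Finset.univ.filter fun m : Messages N ρ =>
    ∀ i, (c N).decoded m b i = ((m i).1, (m i).2 b) with hS
  set S0 := Finset.univ.filter fun m : Messages N ρ => (m, b) ∈ opportunisticError (c N) 0
  set S1 := Finset.univ.filter fun m : Messages N ρ => (m, b) ∈ opportunisticError (c N) 1
  have hsub : (Finset.univ : Finset (Messages N ρ)) ⊆ S ∪ (S0 ∪ S1) := by
    intro m _
    simp only [S, S0, S1, Finset.mem_union, Finset.mem_filter, Finset.mem_univ, true_and]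
    simp only [opportunisticError, Set.mem_ofPred_eq, Fin.forall_fin_two]
    by_cases h0 : (c N).decoded m b 0 = ((m 0).1, (m 0).2 b)
    · by_cases h1 : (c N).decoded m b 1 = ((m 1).1, (m 1).2 b)
      · exact Or.inl ⟨h0, h1⟩
      · exact Or.inr (Or.inr h1)
    · exact Or.inr (Or.inl h0)
  have hle := (Finset.card_le_card hsub).trans ((Finset.card_union_le _ _).trans
    (Nat.add_le_add_left (Finset.card_union_le _ _) _))
  rw [Finset.card_univ] at hle
  have hle' : (Fintype.card (Messages N ρ) : ℝ) ≤ S.card + (S0.card + S1.card) := by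
    exact_mod_cast hle
  have : (Fintype.card (Messages N ρ) : ℝ) ≤ 2 * S.card := by linarith
  exact_mod_cast this

lemma rpow_sum_le {N : ℕ} (h0 : ∀ i, 0 ≤ ρ.1 i) (h1 : ∀ i b, 0 ≤ ρ.2 i b) (i : Fin 2) (b : State) :
    (2 : ℝ) ^ ((N : ℝ) * (ρ.1 i + ρ.2 i b)) ≤
      4 * Fintype.card (Fin (msgCount N (ρ.1 i)) × Fin (msgCount N (ρ.2 i b))) := by
  rw [mul_add, Real.rpow_add (by norm_num), Fintype.card_prod, Fintype.card_fin, Fintype.card_fin]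
  push_cast
  calc _ ≤ (2 * (msgCount N (ρ.1 i) : ℝ)) * (2 * msgCount N (ρ.2 i b)) :=
        mul_le_mul (rpow_le_two_mul_msgCount (h0 i)) (rpow_le_two_mul_msgCount (h1 i b))
          (by positivity) (by positivity)
    _ = _ := by ring

lemma two_pow_eq_rpow (N k : ℕ) : (2 : ℝ) ^ (N * k) = 2 ^ ((N : ℝ) * k) := by
  rw [← Real.rpow_natCast]
  push_cast
  rfl

lemma IsAchievable.rate_le (hp0 : 0 < p) (hp1 : p < 1) (h : IsAchievable nd nc p ρ) (b : State)
    (i : Fin 2) : ρ.1 i + ρ.2 i b ≤ nd := by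
  obtain ⟨h0, h1, -, c, -, hc⟩ := h
  refine le_of_eventually_rpow_le (K := 8) ?_
  filter_upwards [eventually_half_decoded hp0 hp1 b c (fun i => hc i b) h0 h1] with N hN
  obtain ⟨e, G, hG, hcard⟩ := exists_fixed_code h1 (c N) b hN
  have hle := card_le_direct b e (fun i Y => (c N).dec i Y b) G hG i
  refine (rpow_sum_le h0 h1 i b).trans ?_
  rw [← two_pow_eq_rpow]
  set M : Fin 2 → ℕ := fun i => Fintype.card
    (Fin (msgCount N (ρ.1 i)) × Fin (msgCount N (ρ.2 i b))) with hM
  have hprod : Fintype.card ((i : Fin 2) → Fin (msgCount N (ρ.1 i)) × Fin (msgCount N (ρ.2 i b))) =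
      M i * M (i + 1) := by
    rw [Fintype.card_pi]
    fin_cases i <;> simp [hM, Fin.prod_univ_two, mul_comm]
  have hpos : 0 < M (i + 1) := by
    simp [hM, msgCount_pos, h0, h1]
  have : M i * M (i + 1) ≤ (2 * 2 ^ (N * nd)) * M (i + 1) := by
    rw [← hprod]
    calc _ ≤ _ := hcard
      _ ≤ _ := Nat.mul_le_mul_left 2 hle
      _ = _ := by rw [mul_assoc]
  have h2 : M i ≤ 2 * 2 ^ (N * nd) := Nat.le_of_mul_le_mul_right this hpos
  have h3 : (M i : ℝ) ≤ 2 * 2 ^ (N * nd) := by exact_mod_cast h2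
  linarith

lemma rpow_sum_sum_le {N : ℕ} (h0 : ∀ i, 0 ≤ ρ.1 i) (h1 : ∀ i b, 0 ≤ ρ.2 i b) (b : State) :
    (2 : ℝ) ^ ((N : ℝ) * (∑ i, ρ.1 i + ∑ i, ρ.2 i b)) ≤ 16 * Fintype.card
      ((i : Fin 2) → Fin (msgCount N (ρ.1 i)) × Fin (msgCount N (ρ.2 i b))) := by
  have := mul_le_mul (rpow_sum_le (N := N) h0 h1 0 b) (rpow_sum_le (N := N) h0 h1 1 b)
    (by positivity) (by positivity)
  rw [← Real.rpow_add (by norm_num)] at this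
  rw [Fintype.card_pi, Fin.prod_univ_two, Nat.cast_mul, Fin.sum_univ_two, Fin.sum_univ_two]
  refine le_trans (le_of_eq ?_) (this.trans (le_of_eq ?_))
  · congr 1
    ring
  · rw [mul_mul_mul_comm]
    norm_num

lemma IsAchievable.sum_le_interference (hp0 : 0 < p) (hp1 : p < 1) (h : IsAchievable nd nc p ρ)
    (b : State) (i : Fin 2) (hb : b i = true) :
    ∑ i, ρ.1 i + ∑ i, ρ.2 i b ≤ ((max nd nc + (nd - nc) : ℕ) : ℝ) := by
  obtain ⟨h0, h1, -, c, -, hc⟩ := h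
  refine le_of_eventually_rpow_le (K := 32) ?_
  filter_upwards [eventually_half_decoded hp0 hp1 b c (fun i => hc i b) h0 h1] with N hN
  obtain ⟨e, G, hG, hcard⟩ := exists_fixed_code h1 (c N) b hN
  have hle := hcard.trans (Nat.mul_le_mul_left 2
    (card_le_interference b e (fun i Y => (c N).dec i Y b) G hG i hb))
  refine (rpow_sum_sum_le h0 h1 b).trans ?_
  rw [← two_pow_eq_rpow]
  have h3 : (Fintype.card ((i : Fin 2) →
      Fin (msgCount N (ρ.1 i)) × Fin (msgCount N (ρ.2 i b))) : ℝ) ≤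
      2 * 2 ^ (N * (max nd nc + (nd - nc))) := by exact_mod_cast hle
  linarith

lemma IsAchievable.sum_le_genie (hp0 : 0 < p) (hp1 : p < 1) (h : IsAchievable nd nc p ρ)
    (b : State) (hb : ∀ i, b i = true) :
    ∑ i, ρ.1 i + ∑ i, ρ.2 i b ≤ ((2 * max (nd - nc) nc : ℕ) : ℝ) := by
  obtain ⟨h0, h1, -, c, -, hc⟩ := h
  -- 64 = 16 · 4: a factor 16 for rounding down four message counts, and the factor 2 of the good
  -- half, squared.
  refine le_of_eventually_rpow_le (K := 64) ?_
  filter_upwards [eventually_half_decoded hp0 hp1 b c (fun i => hc i b) h0 h1] with N hN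
  obtain ⟨e, G, hG, hcard⟩ := exists_fixed_code h1 (c N) b hN
  have hle := card_sq_le_interference b e (fun i Y => (c N).dec i Y b) G hG (hb 0) (hb 1)
  refine (rpow_sum_sum_le h0 h1 b).trans ?_
  rw [← two_pow_eq_rpow]
  set M := Fintype.card ((i : Fin 2) →
      Fin (msgCount N (ρ.1 i)) × Fin (msgCount N (ρ.2 i b))) with hM
  have hpos : 0 < M := by
    simp [hM, Fin.prod_univ_two, msgCount_pos, h0, h1]
  have hM2 : Fintype.card (Fin (msgCount N (ρ.1 0)) × Fin (msgCount N (ρ.2 0 b))) *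
      Fintype.card (Fin (msgCount N (ρ.1 1)) × Fin (msgCount N (ρ.2 1 b))) = M := by
    rw [hM, Fintype.card_pi, Fin.prod_univ_two]
  have h2 : M * M ≤ (4 * 2 ^ (N * (2 * max (nd - nc) nc))) * M := by
    calc M * M ≤ (2 * G.card) * (2 * G.card) := Nat.mul_le_mul hcard hcard
      _ = 4 * G.card ^ 2 := by ring
      _ ≤ _ := Nat.mul_le_mul_left 4 hle
      _ = 4 * 2 ^ (N * (2 * max (nd - nc) nc)) * M := by
        rw [← hM2]
        ring
  have h3 : (M : ℝ) ≤ 4 * 2 ^ (N * (2 * max (nd - nc) nc)) := by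
    exact_mod_cast Nat.le_of_mul_le_mul_right h2 hpos
  linarith

end Converse

/-! ### Error-free schemes for one channel use -/

/-- In state `b`, one channel use conveys `k i` bits of user `i` to receiver `i`, for both users,
without error. -/
def OneShot (nd nc : ℕ) (b : State) (k : Fin 2 → ℕ) : Prop :=
  ∃ x : Fin 2 → (ℕ → ZMod 2) → ℕ → ZMod 2, ∀ (u u' : Fin 2 → ℕ → ZMod 2) (i : Fin 2),
    (∀ r < max nd nc, levelOutput nd nc b (fun j => x j (u j)) i r =
      levelOutput nd nc b (fun j => x j (u' j)) i r) → ∀ j < k i, u i j = u' i j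

lemma OneShot.swap {nd nc : ℕ} {b : State} {k : Fin 2 → ℕ} (h : OneShot nd nc b k) :
    OneShot nd nc (fun i => b (i + 1)) fun i => k (i + 1) := by
  obtain ⟨x, hx⟩ := h
  refine ⟨fun i => x (i + 1), fun u u' i hi j hj => ?_⟩
  have := hx (fun i => u (i + 1)) (fun i => u' (i + 1)) (i + 1) (fun r hr => ?_) j hj
  · simpa [fin_two_add_add] using this
  · simpa [fin_two_add_add, levelOutput] using hi r hr

lemma exists_mod_eq_of_window (w : ℕ) {d s : ℕ} (hs : s < d) :
    ∃ r, w ≤ r ∧ r < w + d ∧ r % d = s := by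
  have hd : 0 < d := by omega
  refine ⟨w + (s + (d - w % d)) % d, Nat.le_add_right _ _,
    Nat.add_lt_add_left (Nat.mod_lt _ hd) _, ?_⟩
  have hw := Nat.mod_lt w hd
  rw [Nat.add_mod_mod]
  have h1 : w + (s + (d - w % d)) = s + d * (w / d + 1) := by
    have := Nat.div_add_mod w d
    rw [mul_add]
    omega
  rw [h1, Nat.add_mul_mod_self_left, Nat.mod_eq_of_lt hs]

variable {nd nc : ℕ}

lemma oneShot_no_interference : OneShot nd nc s00 ![nd, nd] := by
  refine ⟨fun _ u => u, fun u u' i h j hj => ?_⟩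
  have hj' : j < nd := by fin_cases i <;> simpa using hj
  have := h (j + (max nd nc - nd)) (by omega)
  fin_cases i <;> simpa [levelOutput, s00] using this

lemma levelOutput_weak (h : nc ≤ nd) (b : State) (f g : ℕ → ZMod 2) (i : Fin 2) (r : ℕ) :
    levelOutput nd nc b ![f, g] i r = (![f, g] : Fin 2 → ℕ → ZMod 2) i r +
      if b i ∧ nd - nc ≤ r then (![g, f] : Fin 2 → ℕ → ZMod 2) i (r - (nd - nc)) else 0 := by
  have h1 : max nd nc = nd := max_eq_left h
  rw [levelOutput, h1]
  fin_cases i <;> simp [ite_and]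

lemma levelOutput_strong (h : nd < nc) (b : State) (f g : ℕ → ZMod 2) (i : Fin 2) (r : ℕ) :
    levelOutput nd nc b ![f, g] i r =
      (if nc - nd ≤ r then (![f, g] : Fin 2 → ℕ → ZMod 2) i (r - (nc - nd)) else 0) +
      if b i then (![g, f] : Fin 2 → ℕ → ZMod 2) i r else 0 := by
  have h1 : max nd nc = nc := max_eq_right h.le
  rw [levelOutput, h1]
  fin_cases i <;> simp

/-- The shape in which the one-shot schemes below are given: separate encoders `f`, `g`. -/
lemma oneShot_of_pair {b : State} {k0 k1 : ℕ} (f g : (ℕ → ZMod 2) → ℕ → ZMod 2)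
    (h0 : ∀ a c a' c' : ℕ → ZMod 2, (∀ r < max nd nc,
      levelOutput nd nc b ![f a, g c] 0 r = levelOutput nd nc b ![f a', g c'] 0 r) →
      ∀ j < k0, a j = a' j)
    (h1 : ∀ a c a' c' : ℕ → ZMod 2, (∀ r < max nd nc,
      levelOutput nd nc b ![f a, g c] 1 r = levelOutput nd nc b ![f a', g c'] 1 r) →
      ∀ j < k1, c j = c' j) : OneShot nd nc b ![k0, k1] := by
  refine ⟨![f, g], fun u u' i h => ?_⟩
  have hx (v : Fin 2 → ℕ → ZMod 2) :
      (fun j => (![f, g] : Fin 2 → (ℕ → ZMod 2) → ℕ → ZMod 2) j (v j)) = ![f (v 0), g (v 1)] := by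
    funext j
    fin_cases j <;> rfl
  rw [hx, hx] at h
  fin_cases i
  · exact h0 _ _ _ _ h
  · exact h1 _ _ _ _ h

/-- The second user stays on the top nd - nc levels, which interference never reaches. -/
lemma oneShot_s01_weak (h : nc ≤ nd) : OneShot nd nc s01 ![nd, nd - nc] := by
  refine oneShot_of_pair (fun a => a) (fun c j => if j < nd - nc then c j else 0) ?_ ?_ <;>
    intro a c a' c' hr j hj <;>
    simp only [levelOutput_weak h, s01] at hr <;>
    have := hr j (by omega)
  · simpa using this
  · have h1 : ¬ nd - nc ≤ j := by omega
    simpa [hj, h1] using this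

/-- The first user stays on the bottom nd - nc levels, which vanish at the other receiver. -/
lemma oneShot_s01_weak' (h : nc ≤ nd) : OneShot nd nc s01 ![nd - nc, nd] := by
  refine oneShot_of_pair (fun a j => if nc ≤ j then a (j - nc) else 0) (fun c => c) ?_ ?_ <;>
    intro a c a' c' hr j hj <;>
    simp only [levelOutput_weak h, s01] at hr
  · simpa using hr (j + nc) (by omega)
  · have := hr j (by omega)
    have h1 : ¬ (nd ≤ j + nc ∧ nc ≤ j - (nd - nc)) := by omega
    simpa [← ite_and, h1] using this

/-- The second user's bits arrive below the nd rows hit by interference. -/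
lemma oneShot_s01_strong (h : nd < nc) : OneShot nd nc s01 ![nd, min (nc - nd) nd] := by
  set m := min (nc - nd) nd with hm
  refine oneShot_of_pair (fun a j => if j < nd then a j else 0)
    (fun c j => if nd - m ≤ j then c (j - (nd - m)) else 0) ?_ ?_ <;>
    intro a c a' c' hr j hj <;>
    simp only [levelOutput_strong h, s01] at hr
  · simpa [hj] using hr (j + (nc - nd)) (by omega)
  · have := hr (j + (nd - m) + (nc - nd)) (by omega)
    have h1 : ¬ j + (nd - m) + (nc - nd) < nd := by omega
    have h2 : nd ≤ j + (nd - m) + m := by omega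
    simpa [h1, h2] using this

/-- The first user's few bits interfere only above the rows where the second user's signal arrives.
-/
lemma oneShot_s01_strong' (h : nd < nc) : OneShot nd nc s01 ![min (nc - nd) nd, nd] := by
  set m := min (nc - nd) nd with hm
  refine oneShot_of_pair (fun a j => if j < m then a j else 0) (fun c => c) ?_ ?_ <;>
    intro a c a' c' hr j hj <;>
    simp only [levelOutput_strong h, s01] at hr <;>
    have := hr (j + (nc - nd)) (by omega)
  · simpa [hj] using this
  · have h1 : ¬ j + (nc - nd) < m := by omega
    simpa [h1] using this

lemma oneShot_s11_very_weak (h : 2 * nc ≤ nd) : OneShot nd nc s11 ![nd - nc, nd - nc] := by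
  refine oneShot_of_pair (fun a j => if nc ≤ j then a (j - nc) else 0)
    (fun a j => if nc ≤ j then a (j - nc) else 0) ?_ ?_ <;>
    intro a c a' c' hr j hj <;>
    simp only [levelOutput_weak (show nc ≤ nd by omega), s11] at hr <;>
    have := hr (j + nc) (by omega) <;>
    have h1 : ¬ (nd ≤ j + nc + nc ∧ nc ≤ j + nc - (nd - nc)) := by omega
  · simpa [← ite_and, h1] using this
  · simpa [← ite_and, h1] using this

/-- Common bits on the `2 nc - nd` top levels and private bits on the `nd - nc` bottom levels. -/
def commonPrivate (nd nc : ℕ) (a : ℕ → ZMod 2) (j : ℕ) : ZMod 2 :=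
  if j < 2 * nc - nd then a j else if nc ≤ j then a (j - nc + (2 * nc - nd)) else 0

/-- Private bits vanish at the other receiver, and the interfering common bits fall into the gap of
zeros between own common and private levels; 3 nc ≤ 2 nd makes them fit. -/
lemma commonPrivate_decode (h1 : nd ≤ 2 * nc) (h2 : 3 * nc ≤ 2 * nd) {a c a' c' : ℕ → ZMod 2}
    (hr : ∀ r < nd, commonPrivate nd nc a r +
        (if nd - nc ≤ r then commonPrivate nd nc c (r - (nd - nc)) else 0) =
      commonPrivate nd nc a' r +
        (if nd - nc ≤ r then commonPrivate nd nc c' (r - (nd - nc)) else 0))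
    (j : ℕ) (hj : j < nc) : a j = a' j := by
  by_cases hj' : j < 2 * nc - nd
  · have := hr j (by omega)
    have h3 : ¬ nd - nc ≤ j := by omega
    simpa [commonPrivate, hj', h3] using this
  · have := hr (j - (2 * nc - nd) + nc) (by omega)
    have h3 : ¬ j - (2 * nc - nd) + nc < 2 * nc - nd := by omega
    have h4 : ¬ j - (2 * nc - nd) + nc - (nd - nc) < 2 * nc - nd := by omega
    have h5 : ¬ nc ≤ j - (2 * nc - nd) + nc - (nd - nc) := by omega
    have h6 : j - (2 * nc - nd) + (2 * nc - nd) = j := by omega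
    simpa [commonPrivate, h3, h4, h5, h6] using this

lemma oneShot_s11_moderately_weak (h1 : nd ≤ 2 * nc) (h2 : 3 * nc ≤ 2 * nd) :
    OneShot nd nc s11 ![nc, nc] := by
  have h3 : nc ≤ nd := by omega
  refine oneShot_of_pair (commonPrivate nd nc) (commonPrivate nd nc) ?_ ?_ <;>
    intro a c a' c' hr <;>
    rw [max_eq_left h3] at hr <;>
    simp only [levelOutput_weak h3, s11] at hr
  · exact commonPrivate_decode (a := a) (c := c) (c' := c') h1 h2 (by simpa using hr)
  · exact commonPrivate_decode (a := c) (c := a) (c' := a') h1 h2 (by simpa using hr)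

lemma oneShot_s11_equal (h : nc = nd) : OneShot nd nc s11 ![nd, 0] := by
  subst h
  refine oneShot_of_pair (fun a => a) (fun _ _ => 0) ?_ ?_ <;>
    intro a c a' c' hr j hj <;>
    simp only [levelOutput_weak le_rfl, s11] at hr
  · simpa using hr j (by omega)
  · omega

/-- With d = nd - nc, the first user leaves a gap of d zero levels. The second repeats d bits
periodically on its top levels, so the gap shows the first receiver a full period, and all its
interference can be cancelled. The second receiver reads those d bits on its clean top rows and d
more where the gap arrives. -/
lemma oneShot_s11_weak (h1 : 2 * nd ≤ 3 * nc) (h2 : nc < nd) :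
    OneShot nd nc s11 ![nc, 2 * (nd - nc)] := by
  obtain ⟨d, hd⟩ : ∃ d, d = nd - nc := ⟨_, rfl⟩
  rw [← hd]
  refine oneShot_of_pair
    (fun a j => if j < nd - 2 * d then a j else if nd - d ≤ j then a (j - d) else 0)
    (fun c j => if j < nd - d then c (j % d) else c (j - (nd - 2 * d))) ?_ ?_ <;>
    intro a c a' c' hr <;>
    rw [max_eq_left h2.le] at hr <;>
    simp only [levelOutput_weak h2.le, s11, ← hd] at hr
  · have hc : ∀ s < d, c s = c' s := by
      intro s hs
      obtain ⟨r, hr1, hr2, hr3⟩ := exists_mod_eq_of_window (nd - 3 * d) hs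
      have := hr (r + d) (by omega)
      have e1 : ¬ r + d < nd - 2 * d := by omega
      have e2 : ¬ nd ≤ r + d + d := by omega
      have e3 : r < nd - d := by omega
      simpa [e1, e2, e3, hr3] using this
    have hm (r : ℕ) : c (r % d) = c' (r % d) := hc _ (Nat.mod_lt _ (by omega))
    intro j hj
    by_cases hj' : j < nd - 2 * d
    · have := hr j (by omega)
      have e1 : j - d < nd - d := by omega
      simpa [e1, hj', hm] using this
    · have := hr (j + d) (by omega)
      have e1 : ¬ j + d < nd - 2 * d := by omega
      have e2 : nd ≤ j + d + d := by omega
      have e3 : j < nd - d := by omega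
      simpa [e1, e2, e3, hm] using this
  · intro j hj
    by_cases hj' : j < d
    · have := hr j (by omega)
      have e1 : ¬ d ≤ j := by omega
      have e2 : j < nd - d := by omega
      simpa [e1, e2, Nat.mod_eq_of_lt hj'] using this
    · have := hr (j + (nd - 2 * d)) (by omega)
      have e1 : ¬ j + (nd - 2 * d) < nd - d := by omega
      have e2 : ¬ j + (nd - 2 * d) - d < nd - 2 * d := by omega
      have e3 : ¬ nd ≤ j + (nd - 2 * d) - d + d := by omega
      simpa [e1, e2, e3] using this

/-- The second user repeats its bits with period e = nc - nd. The first receiver reads them on the e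
top rows its own signal does not reach and cancels the rest; the second reads them on rows beyond
the nd interfered ones. -/
lemma oneShot_s11_strong (h : nd < nc) : OneShot nd nc s11 ![nd, min (nc - nd) nd] := by
  obtain ⟨e, he⟩ : ∃ e, e = nc - nd := ⟨_, rfl⟩
  rw [← he]
  refine oneShot_of_pair (fun a j => if j < nd then a j else 0)
    (fun c j => if j < nd then c (j % e) else 0) ?_ ?_ <;>
    intro a c a' c' hr <;>
    rw [max_eq_right h.le] at hr <;>
    simp only [levelOutput_strong h, s11, ← he] at hr
  · have hc : ∀ s < min e nd, c s = c' s := by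
      intro s hs
      have := hr s (by omega)
      have e1 : ¬ e ≤ s := by omega
      have e2 : s < nd := by omega
      have e3 : s % e = s := Nat.mod_eq_of_lt (by omega)
      simpa [e1, e2, e3] using this
    intro j hj
    have := hr (j + e) (by omega)
    by_cases hj' : j + e < nd
    · have h3 := hc (j % e) (by have := Nat.mod_lt j (show e > 0 by omega); omega)
      simpa [hj, hj', h3] using this
    · simpa [hj, hj'] using this
  · intro j hj
    have hw : ∃ r, nd - e ≤ r ∧ r < nd ∧ r % e = j := by
      by_cases hle : e ≤ nd
      · obtain ⟨r, hr1, hr2, hr3⟩ := exists_mod_eq_of_window (nd - e) (show j < e by omega)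
        exact ⟨r, hr1, by omega, hr3⟩
      · exact ⟨j, by omega, by omega, Nat.mod_eq_of_lt (by omega)⟩
    obtain ⟨r, hr1, hr2, hr3⟩ := hw
    have := hr (r + e) (by omega)
    have e1 : ¬ r + e < nd := by omega
    simpa [e1, hr2, hr3] using this

/-- The sum capacity of the channel in a fixed state `b`. -/
def sumCapacity (nd nc : ℕ) (b : State) : ℕ :=
  if b = s00 then 2 * nd
  else if b = s11 then
    min (2 * nd) (min (max nd nc + (nd - nc)) (2 * max (nd - nc) nc))
  else min (2 * nd) (max nd nc + (nd - nc))

lemma state_cases (b : State) : b = s00 ∨ b = s01 ∨ b = s10 ∨ b = s11 := by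
  revert b; decide

/-- The two schemes complement each other, so using them equally often gives each user half the sum
capacity. In symmetric states the second is the first with users exchanged; state 10 mirrors 01. -/
lemma exists_oneShot (nd nc : ℕ) (b : State) :
    ∃ k k' : Fin 2 → ℕ, OneShot nd nc b k ∧ OneShot nd nc b k' ∧
      ∀ i, k i + k' i = sumCapacity nd nc b := by
  have hsymm {b : State} (hb : ∀ i, b (i + 1) = b i) {k0 k1 : ℕ} (h : OneShot nd nc b ![k0, k1])
      (hk : k0 + k1 = sumCapacity nd nc b) : ∃ k k' : Fin 2 → ℕ, OneShot nd nc b k ∧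
      OneShot nd nc b k' ∧ ∀ i, k i + k' i = sumCapacity nd nc b := by
    have h' := h.swap
    simp only [hb] at h'
    refine ⟨_, _, h, h', fun i => ?_⟩
    rw [← hk]
    fin_cases i
    · simp
    · simp [add_comm]
  have h01 : ∃ k k' : Fin 2 → ℕ, OneShot nd nc s01 k ∧ OneShot nd nc s01 k' ∧
      ∀ i, k i + k' i = sumCapacity nd nc s01 := by
    have hne0 : s01 ≠ s00 := by decide
    have hne1 : s01 ≠ s11 := by decide
    rcases le_or_gt nc nd with h | h
    · refine ⟨_, _, oneShot_s01_weak h, oneShot_s01_weak' h, fun i => ?_⟩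
      rw [sumCapacity, if_neg hne0, if_neg hne1]
      fin_cases i <;> simp <;> omega
    · refine ⟨_, _, oneShot_s01_strong h, oneShot_s01_strong' h, fun i => ?_⟩
      rw [sumCapacity, if_neg hne0, if_neg hne1]
      fin_cases i <;> simp <;> omega
  rcases state_cases b with rfl | rfl | rfl | rfl
  · exact hsymm (by decide) oneShot_no_interference (by simp [sumCapacity]; omega)
  · exact h01
  · obtain ⟨k, k', hk, hk', hsum⟩ := h01
    have hs : (fun i => s01 (i + 1)) = s10 := by decide
    have hk2 := hk.swap
    have hk2' := hk'.swap
    rw [hs] at hk2 hk2'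
    refine ⟨_, _, hk2, hk2', fun i => ?_⟩
    rw [hsum]
    rfl
  · have hs : sumCapacity nd nc s11 =
        min (2 * nd) (min (max nd nc + (nd - nc)) (2 * max (nd - nc) nc)) := by
      rw [sumCapacity, if_neg (by decide), if_pos rfl]
    have hb : ∀ i, s11 (i + 1) = s11 i := by decide
    rcases lt_trichotomy nc nd with h | h | h
    · by_cases h1 : 2 * nc ≤ nd
      · exact hsymm hb (oneShot_s11_very_weak h1) (by omega)
      · by_cases h2 : 3 * nc ≤ 2 * nd
        · exact hsymm hb (oneShot_s11_moderately_weak (by omega) h2) (by omega)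
        · exact hsymm hb (oneShot_s11_weak (by omega) h) (by omega)
    · exact hsymm hb (oneShot_s11_equal h) (by omega)
    · exact hsymm hb (oneShot_s11_strong h) (by omega)

/-! ### Block codes by alternating the one-shot schemes -/

lemma levelOutput_congr {b : State} {x x' : Fin 2 → ℕ → ZMod 2} {i : Fin 2} {r : ℕ}
    (hr : r < max nd nc) (h : ∀ j, ∀ s < max nd nc, x j s = x' j s) :
    levelOutput nd nc b x i r = levelOutput nd nc b x' i r := by
  rw [levelOutput, levelOutput, h i _ (by omega), h (i + 1) _ (by omega)]

/-- The infinite extension by `0` of a string of bits. -/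
def extendBits {k : ℕ} (u : Fin k → ZMod 2) (j : ℕ) : ZMod 2 :=
  if h : j < k then u ⟨j, h⟩ else 0

lemma extendBits_coe {k : ℕ} (u : Fin k → ZMod 2) (j : Fin k) : extendBits u j = u j :=
  dif_pos j.2

lemma exists_block_encoders {N : ℕ} {b : State} (κ : Fin N → Fin 2 → ℕ)
    (h : ∀ t, OneShot nd nc b (κ t)) :
    ∃ x : (i : Fin 2) → ((t : Fin N) → Fin (κ t i) → ZMod 2) → Block nd nc N,
      ∀ (a a' : (i : Fin 2) → (t : Fin N) → Fin (κ t i) → ZMod 2) (i : Fin 2),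
      channelOutput nd nc b (fun j => x j (a j)) i =
        channelOutput nd nc b (fun j => x j (a' j)) i → a i = a' i := by
  choose x hx using h
  refine ⟨fun i a => Matrix.of fun r t => x t i (extendBits (a t)) r, fun a a' i hY => ?_⟩
  funext t
  have := hx t (fun j => extendBits (a j t)) (fun j => extendBits (a' j t)) i (fun r hr => ?_)
  · funext j
    simpa [extendBits_coe] using this j j.2
  · have h1 := congrFun (congrFun hY ⟨r, hr⟩) t
    rw [channelOutput_apply, channelOutput_apply] at h1
    rw [levelOutput_congr hr fun j s hs => ?_, h1, levelOutput_congr hr fun j s hs => ?_]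
    · rw [rowEntry_of_lt _ _ hs]
      rfl
    · rw [rowEntry_of_lt _ _ hs]
      rfl

lemma half_mul_le_sum_alternating {k k' C : ℕ} (h : k + k' = C) (N : ℕ) :
    N / 2 * C ≤ ∑ t ∈ Finset.range N, if t % 2 = 0 then k else k' := by
  have heven (m : ℕ) : ∑ t ∈ Finset.range (2 * m), (if t % 2 = 0 then k else k') = m * C := by
    induction m with
    | zero => simp
    | succ m ih =>
      rw [mul_add, mul_one, Finset.sum_range_succ, Finset.sum_range_succ, ih,
        if_pos (by omega), if_neg (by omega), add_mul, one_mul, ← h, add_assoc]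
  rw [← heven]
  exact Finset.sum_le_sum_of_subset (Finset.range_mono (by omega))

/-- Two message sets with at most `2 ^ (⌊N / 2⌋ C)` elements each, `C` being the sum capacity of
state `b`, can be conveyed in state `b` without error. -/
lemma exists_zero_error_code {N : ℕ} {b : State} {B : Fin 2 → Type} [∀ i, Fintype (B i)]
    [∀ i, Nonempty (B i)]
    (hB : ∀ i, Fintype.card (B i) ≤ 2 ^ (N / 2 * sumCapacity nd nc b)) :
    ∃ (x : (i : Fin 2) → B i → Block nd nc N) (g : (i : Fin 2) → Block nd nc N → B i),
      ∀ (m : (i : Fin 2) → B i) i, g i (channelOutput nd nc b (fun j => x j (m j)) i) = m i := by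
  obtain ⟨k, k', hk, hk', hsum⟩ := exists_oneShot nd nc b
  obtain ⟨x, hx⟩ := exists_block_encoders (N := N) (fun t => if (t : ℕ) % 2 = 0 then k else k')
    (fun t => by split_ifs <;> assumption)
  have hemb (i : Fin 2) : Nonempty (B i ↪
      ((t : Fin N) → Fin ((if (t : ℕ) % 2 = 0 then k else k') i) → ZMod 2)) := by
    refine Function.Embedding.nonempty_of_card_le ((hB i).trans ?_)
    simp only [Fintype.card_pi, Finset.prod_const, ZMod.card, Finset.card_univ, Fintype.card_fin,
      Finset.prod_pow_eq_pow_sum]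
    refine Nat.pow_le_pow_right (by norm_num) ((half_mul_le_sum_alternating (hsum i) N).trans ?_)
    rw [← Fin.sum_univ_eq_sum_range (fun t => if t % 2 = 0 then k i else k' i)]
    exact Finset.sum_le_sum fun t _ => by split_ifs <;> rfl
  have φ := fun i => (hemb i).some
  refine ⟨fun i a => x i (φ i a), fun i => Function.extend
    (fun m : (i : Fin 2) → B i => channelOutput nd nc b (fun j => x j (φ j (m j))) i)
    (fun m => m i) fun _ => Classical.arbitrary _, fun m i => ?_⟩
  exact Function.FactorsThrough.extend_apply
    (fun m m' h => (φ i).injective (hx (fun j => φ j (m j)) (fun j => φ j (m' j)) i h)) _ m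

lemma exists_opportunisticCode {N : ℕ} {ρ : RateTuple} (h0 : ∀ i, 0 ≤ ρ.1 i)
    (h1 : ∀ i b, 0 ≤ ρ.2 i b)
    (h : ∀ i b, (N : ℝ) * (ρ.1 i + ρ.2 i b) ≤ (N / 2 : ℕ) * sumCapacity nd nc b) :
    ∃ c : OpportunisticCode nd nc N ρ, ∀ m b i,
      c.decoded m b i = ((m i).1, (m i).2 b) := by
  have hne (i : Fin 2) (b : State) :
      Nonempty (Fin (msgCount N (ρ.1 i)) × Fin (msgCount N (ρ.2 i b))) :=
    ⟨⟨0, msgCount_pos (h0 i)⟩, ⟨0, msgCount_pos (h1 i b)⟩⟩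
  have hcard (b : State) (i : Fin 2) :
      Fintype.card (Fin (msgCount N (ρ.1 i)) × Fin (msgCount N (ρ.2 i b))) ≤
        2 ^ (N / 2 * sumCapacity nd nc b) := by
    have : ((msgCount N (ρ.1 i) * msgCount N (ρ.2 i b) : ℕ) : ℝ) ≤
        (2 : ℝ) ^ (N / 2 * sumCapacity nd nc b) := by
      push_cast
      calc _ ≤ (2 : ℝ) ^ ((N : ℝ) * ρ.1 i) * 2 ^ ((N : ℝ) * ρ.2 i b) :=
            mul_le_mul (msgCount_le _ _) (msgCount_le _ _) (by positivity) (by positivity)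
        _ = (2 : ℝ) ^ ((N : ℝ) * (ρ.1 i + ρ.2 i b)) := by
            rw [← Real.rpow_add (by norm_num), mul_add]
        _ ≤ (2 : ℝ) ^ (((N / 2 : ℕ) : ℝ) * sumCapacity nd nc b) :=
            Real.rpow_le_rpow_of_exponent_le (by norm_num) (h i b)
        _ = _ := (two_pow_eq_rpow _ _).symm
    rw [Fintype.card_prod, Fintype.card_fin, Fintype.card_fin]
    exact_mod_cast this
  choose x g hg using fun b => exists_zero_error_code (nd := nd) (nc := nc) (b := b) (hcard b)
  exact ⟨⟨fun i u b => x b i (u.1, u.2 b), fun i Y b => g b i Y⟩,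
    fun m b i => hg b (fun j => ((m j).1, (m j).2 b)) i⟩

lemma isAchievable_of_le {p : unitInterval} {ρ : RateTuple} (h0 : ∀ i, 0 ≤ ρ.1 i)
    (h1 : ∀ i b, 0 ≤ ρ.2 i b) (h11 : ∀ i, ρ.2 i s11 = 0) {θ : ℝ} (hθ : θ < 1)
    (h : ∀ i b, ρ.1 i + ρ.2 i b ≤ θ * (sumCapacity nd nc b / 2)) :
    IsAchievable nd nc p ρ := by
  -- From this length on, the slack N(1 - θ) ≥ 1 pays for the channel use lost when N is odd.
  obtain ⟨N₀, hN₀⟩ := exists_nat_ge (1 / (1 - θ))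
  have hcode (N : ℕ) : ∃ c : OpportunisticCode nd nc N ρ, N₀ ≤ N → ∀ m b i,
      c.decoded m b i = ((m i).1, (m i).2 b) := by
    by_cases hN : N₀ ≤ N
    · obtain ⟨c, hc⟩ := exists_opportunisticCode (N := N) (nd := nd) (nc := nc) h0 h1 fun i b => by
        have hN' : 1 ≤ (N : ℝ) * (1 - θ) := by
          rw [← div_le_iff₀ (by linarith)]
          exact hN₀.trans (by exact_mod_cast hN)
        have hhalf : (N : ℝ) ≤ 2 * (N / 2 : ℕ) + 1 := by
          have : N ≤ 2 * (N / 2) + 1 := by omega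
          exact_mod_cast this
        calc (N : ℝ) * (ρ.1 i + ρ.2 i b) ≤ N * (θ * (sumCapacity nd nc b / 2)) :=
              mul_le_mul_of_nonneg_left (h i b) (by positivity)
          _ = (N * θ / 2) * sumCapacity nd nc b := by ring
          _ ≤ (N / 2 : ℕ) * sumCapacity nd nc b :=
              mul_le_mul_of_nonneg_right (by linarith) (by positivity)
      exact ⟨c, fun _ => hc⟩
    · exact ⟨⟨fun _ _ _ => 0, fun i _ b =>
        (⟨0, msgCount_pos (h0 i)⟩, ⟨0, msgCount_pos (h1 i b)⟩)⟩, fun h => absurd h hN⟩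
  choose c hc using hcode
  refine ⟨h0, h1, h11, c, ?_, fun i b => ?_⟩
  · refine tendsto_const_nhds.congr' ?_
    filter_upwards [eventually_ge_atTop N₀] with N hN
    have : worstCaseError (c N) = ∅ := by
      ext ω
      simp [worstCaseError, hc N hN]
    rw [this, measureReal_empty]
  · refine tendsto_const_nhds.congr' ?_
    filter_upwards [eventually_ge_atTop N₀] with N hN
    have : opportunisticError (c N) i = ∅ := by
      ext ω
      simp [opportunisticError, hc N hN]
    rw [this, measureReal_empty]

lemma mem_capacityRegion_of_le {p : unitInterval} {ρ : RateTuple} (h0 : ∀ i, 0 ≤ ρ.1 i)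
    (h1 : ∀ i b, 0 ≤ ρ.2 i b) (h11 : ∀ i, ρ.2 i s11 = 0)
    (h : ∀ i b, ρ.1 i + ρ.2 i b ≤ sumCapacity nd nc b / 2) :
    ρ ∈ capacityRegion nd nc p := by
  have hlim : Tendsto (fun θ : ℝ => θ • ρ) (𝓝[<] 1) (𝓝 ρ) := by
    have : Continuous fun θ : ℝ => θ • ρ := by fun_prop
    simpa using (this.tendsto 1).mono_left nhdsWithin_le_nhds
  refine mem_closure_of_tendsto hlim ?_
  filter_upwards [self_mem_nhdsWithin, mem_nhdsWithin_of_mem_nhds (lt_mem_nhds zero_lt_one)]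
    with θ hθ1 hθ0
  have hθ0' : (0 : ℝ) < θ := hθ0
  refine isAchievable_of_le (θ := θ) (fun i => mul_nonneg hθ0'.le (h0 i))
    (fun i b => mul_nonneg hθ0'.le (h1 i b)) (fun i => ?_) hθ1 fun i b => ?_
  · simp [h11]
  · have := mul_le_mul_of_nonneg_left (h i b) hθ0'.le
    simpa [mul_add] using this

/-! ### Assembling the region -/

lemma cast_tsub_eq_max (m n : ℕ) : ((m - n : ℕ) : ℝ) = max ((m : ℝ) - n) 0 := by
  rcases le_total n m with h | h
  · rw [Nat.cast_sub h, max_eq_left (sub_nonneg.2 (by exact_mod_cast h))]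
  · rw [Nat.sub_eq_zero_of_le h, max_eq_right (sub_nonpos.2 (by exact_mod_cast h)), Nat.cast_zero]

/-- The symmetric rate tuple with prescribed sum rates. -/
def symmetricRates (R ΔR00 ΔR01 ΔR10 : ℝ) : RateTuple :=
  (fun _ => R / 2, fun _ b => if b = s00 then ΔR00 / 2 else if b = s01 then ΔR01 / 2
    else if b = s10 then ΔR10 / 2 else 0)

end BurstyIC

end

open BurstyIC in
theorem theorem6 (nd nc : ℕ) (p : unitInterval) (hp0 : 0 < p) (hp1 : p < 1) :
    BurstyIC.opportunisticSumCapacityRegion nd nc p =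
      {t : ℝ × ℝ × ℝ × ℝ | ∃ R ΔR00 ΔR01 ΔR10 : ℝ, t = (R, ΔR00, ΔR01, ΔR10) ∧
        0 ≤ R ∧ 0 ≤ ΔR00 ∧ 0 ≤ ΔR01 ∧ 0 ≤ ΔR10 ∧
        R ≤ 2 * (nd : ℝ) ∧
        R ≤ max ((nd : ℝ) - nc) 0 + max (nd : ℝ) nc ∧
        R ≤ 2 * max (max ((nd : ℝ) - nc) 0) (nc : ℝ) ∧
        R + ΔR00 ≤ 2 * (nd : ℝ) ∧
        R + ΔR01 ≤ max ((nd : ℝ) - nc) 0 + max (nd : ℝ) nc ∧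
        R + ΔR01 ≤ 2 * (nd : ℝ) ∧
        R + ΔR10 ≤ max ((nd : ℝ) - nc) 0 + max (nd : ℝ) nc ∧
        R + ΔR10 ≤ 2 * (nd : ℝ)} := by
  have hne : s01 ≠ s00 ∧ s10 ≠ s00 ∧ s10 ≠ s01 ∧ s11 ≠ s00 ∧ s11 ≠ s01 ∧ s11 ≠ s10 := by decide
  obtain ⟨n1, n2, n3, n4, n5, n6⟩ := hne
  rw [← cast_tsub_eq_max]
  apply Set.Subset.antisymm
  · have hsub : capacityRegion nd nc p ⊆ {ρ : RateTuple |
        0 ≤ ∑ i, ρ.1 i ∧ 0 ≤ ∑ i, ρ.2 i s00 ∧ 0 ≤ ∑ i, ρ.2 i s01 ∧ 0 ≤ ∑ i, ρ.2 i s10 ∧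
        ∑ i, ρ.1 i ≤ 2 * max ((nd - nc : ℕ) : ℝ) nc ∧
        ∑ i, ρ.1 i + ∑ i, ρ.2 i s00 ≤ 2 * (nd : ℝ) ∧
        ∑ i, ρ.1 i + ∑ i, ρ.2 i s01 ≤ ((nd - nc : ℕ) : ℝ) + max (nd : ℝ) nc ∧
        ∑ i, ρ.1 i + ∑ i, ρ.2 i s01 ≤ 2 * (nd : ℝ) ∧
        ∑ i, ρ.1 i + ∑ i, ρ.2 i s10 ≤ ((nd - nc : ℕ) : ℝ) + max (nd : ℝ) nc ∧
        ∑ i, ρ.1 i + ∑ i, ρ.2 i s10 ≤ 2 * (nd : ℝ)} := by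
      refine closure_minimal ?_ ?_
      · intro ρ hρ
        have hρ' : IsAchievable nd nc p ρ := hρ
        have h2 (b : State) : ∑ i, ρ.1 i + ∑ i, ρ.2 i b ≤ 2 * (nd : ℝ) := by
          have e0 := hρ'.rate_le hp0 hp1 b 0
          have e1 := hρ'.rate_le hp0 hp1 b 1
          simp only [Fin.sum_univ_two]
          linarith
        have h01 := hρ'.sum_le_interference hp0 hp1 s01 1 rfl
        have h10 := hρ'.sum_le_interference hp0 hp1 s10 0 rfl
        have h11 := hρ'.sum_le_genie hp0 hp1 s11 (by decide)
        have hz : ∑ i, ρ.2 i s11 = 0 := Finset.sum_eq_zero fun i _ => hρ'.2.2.1 i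
        rw [hz, add_zero] at h11
        push_cast at h01 h10 h11
        refine ⟨Finset.sum_nonneg fun i _ => hρ'.1 i, Finset.sum_nonneg fun i _ => hρ'.2.1 i _,
          Finset.sum_nonneg fun i _ => hρ'.2.1 i _, Finset.sum_nonneg fun i _ => hρ'.2.1 i _,
          h11, h2 _, by linarith, h2 _, by linarith, h2 _⟩
      · simp only [Set.ofPred_and]
        repeat' apply IsClosed.inter
        all_goals exact isClosed_le (by fun_prop) (by fun_prop)
    rintro _ ⟨ρ, hρ, rfl⟩
    obtain ⟨a1, a2, a3, a4, a5, a6, a7, a8, a9, a10⟩ := hsub hρ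
    exact ⟨_, _, _, _, rfl, a1, a2, a3, a4, by linarith, by linarith, a5, a6, a7, a8, a9, a10⟩
  · rintro _ ⟨R, r0, r1, r2, rfl, a1, a2, a3, a4, b1, b2, b3, b4, b5, b6, b7, b8⟩
    refine ⟨symmetricRates R r0 r1 r2, mem_capacityRegion_of_le ?_ ?_ ?_ ?_, ?_⟩
    · intro i
      simp only [symmetricRates]
      linarith
    · intro i b
      simp only [symmetricRates]
      split_ifs <;> linarith
    · intro i
      simp [symmetricRates, n4, n5, n6]
    · intro i b
      have hC : (sumCapacity nd nc s11 : ℝ) = min (2 * (nd : ℝ))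
          (min (max (nd : ℝ) nc + (nd - nc : ℕ)) (2 * max ((nd - nc : ℕ) : ℝ) nc)) := by
        simp [sumCapacity, n4]
      have hC00 : (sumCapacity nd nc s00 : ℝ) = 2 * (nd : ℝ) := by
        simp [sumCapacity]
      have hC01 : (sumCapacity nd nc s01 : ℝ) =
          min (2 * (nd : ℝ)) (max (nd : ℝ) nc + (nd - nc : ℕ)) := by
        simp [sumCapacity, n1, n5.symm]
      have hC10 : (sumCapacity nd nc s10 : ℝ) =
          min (2 * (nd : ℝ)) (max (nd : ℝ) nc + (nd - nc : ℕ)) := by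
        simp [sumCapacity, n2, n6.symm]
      rcases state_cases b with rfl | rfl | rfl | rfl
      · rw [hC00]
        simp only [symmetricRates, if_true]
        linarith
      · rw [hC01]
        simp only [symmetricRates, if_true, if_neg n1]
        have := le_min b6 (b5.trans_eq (add_comm _ _))
        linarith
      · rw [hC10]
        simp only [symmetricRates, if_true, if_neg n2, if_neg n3]
        have := le_min b8 (b7.trans_eq (add_comm _ _))
        linarith
      · rw [hC]
        simp only [symmetricRates, if_neg n4, if_neg n5, if_neg n6]
        have := le_min b1 (le_min (b2.trans_eq (add_comm _ _)) b3)
        linarith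
    · simp [sumRates, symmetricRates, n1, n2, n3, mul_div_cancel₀]
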